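/- Let $\mathbb F_q$ be a finite field, and let $\mathrm{Sym}_q(m)$ be the $\mathbb F_q$-vector space of symmetric $m\times m$ matrices over $\mathbb F_q$, with the rank distance $d(A,B)=\mathrm{rk}(A-B)$. A symmetric rank-metric code is an $\mathbb F_q$-linear subspace $C$ of $\mathrm{Sym}_q(m)$. Its minimum distance is $d(C)=\min\{d(A,B): A,B\in C,\ A\neq B\}$, and its covering density is $$D(C)=\frac{|C|\,B_t}{q^{(m^2+m)/2}},\qquad t=\Big\lfloor \frac{d(C)-1}{2}\Big\rfloor,$$ where $B_t$ is the number of matrices of rank at most $t$ in $\mathrm{Sym}_q(m)$ (the size of any ball of radius $t$). A sequence $(C_i)_{i\in\mathbb N}$ of such codes, $C_i\subseteq \mathrm{Sym}_q(m_i)$, all with the same minimum distance $d$, is called quasi-perfect if $\lim_{i\to\infty}D(C_i)=1$. **Proposition.** Let $(C_i)_{i\in\mathbb N}$ be a sequence of symmetric rank-metric codes $C_i\subseteq\mathrm{Sym}_q(m_i)$ over a fixed field $\mathbb F_q$, all with the same minimum distance $d\in\{3,4\}$. 1. If $d=3$ and $m_i$ is even for infinitely many indices $i$, then $(C_i)_i$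 is not quasi-perfect. 2. If $d=4$, then $D(C_i)\le q^{-m_i/2}$ for every $i$; consequently $\lim_{i\to\infty}D(C_i)=0$ whenever $m_i\to\infty$. In any case (whether or not $m_i\to\infty$), $(C_i)_i$ is not quasi-perfect. -/

import Mathlib

open Filter Topology

namespace SymRank

/-- `Sym_q(m)`: the `F`-vector space of symmetric `m × m` matrices over `F`. -/
def SymMat (F : Type*) [Field F] (m : ℕ) : Submodule F (Matrix (Fin m) (Fin m) F) where
  carrier := {A | A.IsSymm}
  zero_mem' := Matrix.isSymm_zero
  add_mem' := fun hA hB => hA.add hB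
  smul_mem' := fun c _ hA => hA.smul c

/-- A symmetric rank-metric code: an `F`-linear subspace of `Sym_q(m)`. -/
abbrev SymCode (F : Type*) [Field F] (m : ℕ) := Submodule F (SymMat F m)

/-- The rank distance `rk (A - B)`. -/
noncomputable def rankDist {F : Type*} [Field F] {m : ℕ} (A B : SymMat F m) : ℕ :=
  ((A : Matrix (Fin m) (Fin m) F) - (B : Matrix (Fin m) (Fin m) F)).rank

/-- The minimum distance of a code, i.e. the minimum of the rank distances of pairs of distinct
codewords. (It takes the value `0` exactly when there is no such pair.) -/
noncomputable def minDist {F : Type*} [Field F] {m : ℕ} (C : SymCode F m) : ℕ :=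
  sInf {k : ℕ | ∃ A ∈ C, ∃ B ∈ C, A ≠ B ∧ rankDist A B = k}

/-- The sphere of radius `t` centered in `M`. -/
def sphere {F : Type*} [Field F] {m : ℕ} (M : SymMat F m) (t : ℕ) : Set (SymMat F m) :=
  {N | rankDist M N = t}

/-- The ball of radius `t` centered in `M`. -/
def ball {F : Type*} [Field F] {m : ℕ} (M : SymMat F m) (t : ℕ) : Set (SymMat F m) :=
  ⋃ i ∈ Set.Iic t, sphere M i

/-- `B_t`: the size of a ball of radius `t` in `Sym_q(m)`; see `ncard_ball` for the
independence of the center. -/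
noncomputable def ballSize (F : Type*) [Field F] (m t : ℕ) : ℕ :=
  (ball (0 : SymMat F m) t).ncard

theorem mem_ball {F : Type*} [Field F] {m : ℕ} (M N : SymMat F m) (t : ℕ) :
    N ∈ ball M t ↔ rankDist M N ≤ t := by
  simp [ball, sphere]

theorem ncard_ball {F : Type*} [Field F] {m : ℕ} (M : SymMat F m) (t : ℕ) :
    (ball M t).ncard = ballSize F m t := by
  have h : ball M t = (fun N => M + N) '' ball (0 : SymMat F m) t := by
    ext N
    simp only [Set.mem_image, mem_ball]
    constructor
    · intro hN
      refine ⟨N - M, ?_, by abel⟩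
      simpa [rankDist] using hN
    · rintro ⟨K, hK, rfl⟩
      simpa [rankDist] using hK
  rw [h, Set.ncard_image_of_injective _ (add_right_injective M), ballSize]

/-- The covering density `|C| B_t / q^((m^2+m)/2)` of a code `C` in `Sym_q(m)`, where
`t = ⌊(d(C) - 1) / 2⌋` and `q = |F|`. -/
noncomputable def coveringDensity {F : Type*} [Field F] {m : ℕ} (C : SymCode F m) : ℝ :=
  ((Nat.card C : ℝ) * (ballSize F m ((minDist C - 1) / 2) : ℝ)) /
    (Nat.card F : ℝ) ^ ((m ^ 2 + m) / 2)

/-- A family of codes `C i` in `Sym_q(m i)` is quasi-perfect if its covering densities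
converge to `1`. -/
def QuasiPerfect {F : Type*} [Field F] {m : ℕ → ℕ} (C : ∀ i, SymCode F (m i)) : Prop :=
  Tendsto (fun i => coveringDensity (C i)) atTop (𝓝 1)

end SymRank

/-! Let `K` be the quotient of the symmetric matrices by `C`, and let `Q v` be the class of `v vᵀ`
in `K`. For `d = 3, 4` the radius is 1. At most `q ^ m` symmetric matrices have rank at most one, so
the density is at most `q ^ (m - dim K)`; everything reduces to bounding `dim K` below.

The tangent space of `Q` at `v` is spanned by `Q v` and the `polar Q v w`. Its representatives have
rank at most 2, so `d ≥ 3` forces dimension `m` for `v ≠ 0`. A functional `c` kills it exactly when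
`v` lies in the radical of the form `c ∘ Q`. Together with the count of zeros of a quadratic form
(`card_zeros`), this gives both bounds.

If `m` is even and `dim K = m`, every `c ≠ 0` gives a form with zero radical, whose zero count
differs from `q ^ (m - 1)`. But the rank-one matrices biject onto `K`, which forces exactly `q ^ (m
- 1)` zeros (`not_injective_rescaling`). So `dim K > m` and the density is at most `1/2`.

If `d = 4`, moreover `Q u` avoids the tangent space at `v` unless `u` is on the line of `v`.
Counting pairs `(c, u)` with `v` in the radical of `c ∘ Q` and `c (Q u) = 0` in two ways, and
comparing powers of `q`, yields `dim K ≥ 3m/2` (`three_mul_finrank_le`). All arguments are uniform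
in the characteristic. -/

namespace QuadraticMap

open Module

/-! ### Splitting off a hyperbolic plane. -/

section Hyperbolic

variable {F V : Type*} [Field F] [AddCommGroup V] [Module F V]

/-- The orthogonal complement of a pair of vectors. -/
def pairPerp (Q : QuadraticForm F V) (x y : V) : Submodule F V :=
  LinearMap.ker (Q.polarBilin x) ⊓ LinearMap.ker (Q.polarBilin y)

theorem mem_pairPerp {Q : QuadraticForm F V} {x y v : V} :
    v ∈ pairPerp Q x y ↔ polar Q x v = 0 ∧ polar Q y v = 0 := by
  simp [pairPerp]

variable {Q : QuadraticForm F V} {x y : V}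

/-- A hyperbolic pair splits off its orthogonal complement. -/
def hyperbolicEquiv (hx : Q x = 0) (hy : Q y = 0) (hxy : polar Q x y = 1) :
    (F × F × pairPerp Q x y) ≃ₗ[F] V where
  toFun p := p.1 • x + p.2.1 • y + p.2.2
  map_add' p r := by simp only [Prod.fst_add, Prod.snd_add, add_smul, Submodule.coe_add]; abel
  map_smul' c p := by simp [mul_smul, smul_add]
  invFun v := (polar Q y v, polar Q x v, ⟨v - polar Q y v • x - polar Q x v • y, by
    have hyx : polar Q y x = 1 := by rw [polar_comm, hxy]
    rw [mem_pairPerp]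
    constructor <;> simp [polar_sub_right, polar_smul_right, hx, hy, hxy, hyx]⟩)
  left_inv := by
    rintro ⟨a, b, u, hu⟩
    rw [mem_pairPerp] at hu
    have hyx : polar Q y x = 1 := by rw [polar_comm, hxy]
    have h1 : polar Q y (a • x + b • y + u) = a := by simp [hy, hyx, hu.2]
    have h2 : polar Q x (a • x + b • y + u) = b := by simp [hx, hxy, hu.1]
    ext
    · exact h1
    · exact h2
    · simp only [h1, h2]; abel
  right_inv v := by simp only; abel

theorem hyperbolicEquiv_apply (hx : Q x = 0) (hy : Q y = 0) (hxy : polar Q x y = 1)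
    (a b : F) (u : pairPerp Q x y) :
    Q (hyperbolicEquiv hx hy hxy (a, b, u)) = a * b + Q u := by
  have hu := mem_pairPerp.1 u.2
  change Q (a • x + b • y + (u : V)) = _
  rw [QuadraticMap.map_add Q, QuadraticMap.map_add Q (a • x)]
  simp [hx, hy, hxy, hu.1, hu.2, QuadraticMap.map_smul]
  ring

/-- A radical vector is orthogonal to `x` and `y`, and the hyperbolic plane contributes no radical.
Hence the radical dimension is unchanged in the induction of `card_zeros`. -/
theorem radical_eq_map_pairPerp (hx : Q x = 0) (hy : Q y = 0) (hxy : polar Q x y = 1) :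
    Q.radical = (radical (Q.comp (pairPerp Q x y).subtype)).map (pairPerp Q x y).subtype := by
  ext v
  simp only [Submodule.mem_map, mem_radical_iff', Submodule.subtype_apply, comp_apply]
  constructor
  · rintro ⟨h0, h⟩
    have hp : ∀ w, polar Q w v = 0 := fun w => by rw [polar_comm, polar, h, h0]; simp
    exact ⟨⟨v, mem_pairPerp.2 ⟨hp x, hp y⟩⟩, ⟨h0, fun n => h n⟩, rfl⟩
  · rintro ⟨u, ⟨h0, h⟩, rfl⟩
    refine ⟨h0, fun n => ?_⟩
    obtain ⟨⟨a, b, w⟩, rfl⟩ := (hyperbolicEquiv hx hy hxy).surjective n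
    have : (u : V) + hyperbolicEquiv hx hy hxy (a, b, w)
        = hyperbolicEquiv hx hy hxy (a, b, u + w) := by
      simp only [hyperbolicEquiv, LinearEquiv.coe_mk, LinearMap.coe_mk, AddHom.coe_mk,
        Submodule.coe_add]
      abel
    rw [this, hyperbolicEquiv_apply, hyperbolicEquiv_apply]
    have := h w
    rw [Submodule.coe_add]
    exact congrArg _ this

theorem exists_hyperbolic_pair (hx : Q x = 0) (hr : x ∉ Q.radical) :
    ∃ y, Q y = 0 ∧ polar Q x y = 1 := by
  have : ∃ z, polar Q x z ≠ 0 := by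
    by_contra! h
    exact hr ⟨hx, by ext z; simpa using h z⟩
  obtain ⟨z, hz⟩ := this
  obtain ⟨z', h1⟩ : ∃ z', polar Q x z' = 1 := ⟨(polar Q x z)⁻¹ • z, by simp [hz]⟩
  have h2 : polar Q x x = 0 := by simp [hx]
  -- Adding a multiple of the singular vector `x` changes `Q z'` linearly and leaves the pairing
  -- with `x` fixed.
  refine ⟨z' + (-Q z') • x, ?_, ?_⟩
  · rw [QuadraticMap.map_add Q, QuadraticMap.map_smul, hx, polar_smul_right, polar_comm, h1]
    simp
  · rw [polar_add_right, polar_smul_right, h1, h2]; simp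

end Hyperbolic

/-! ### Zeros of a quadratic form over a finite field. -/

section Finite

variable {F : Type*} [Field F] [Finite F] {V : Type*} [AddCommGroup V] [Module F V]
  [Module.Finite F V]

/-- Chevalley–Warning: in three or more variables the characteristic divides the number of zeros,
which cannot then be 1. -/
theorem finrank_le_two_of_anisotropic {Q : QuadraticForm F V} (hQ : Q.Anisotropic) :
    finrank F V ≤ 2 := by
  classical
  by_contra! h
  have := Fintype.ofFinite F
  obtain ⟨B, rfl⟩ := LinearMap.BilinMap.toQuadraticMap_surjective Q
  let b := finBasis F V
  let f : MvPolynomial (Fin (finrank F V)) F :=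
    ∑ i, ∑ j, MvPolynomial.C (B (b i) (b j)) * (MvPolynomial.X i * MvPolynomial.X j)
  have hf : f.totalDegree < Fintype.card (Fin (finrank F V)) := by
    rw [Fintype.card_fin]
    refine lt_of_le_of_lt ?_ h
    refine MvPolynomial.totalDegree_finsetSum_le fun i _ =>
      MvPolynomial.totalDegree_finsetSum_le fun j _ => ?_
    refine (MvPolynomial.totalDegree_mul _ _).trans ?_
    rw [MvPolynomial.totalDegree_C, zero_add]
    refine (MvPolynomial.totalDegree_mul _ _).trans ?_
    simp [MvPolynomial.totalDegree_X]
  have he : ∀ x, MvPolynomial.eval x f = B.toQuadraticMap (b.equivFun.symm x) := by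
    intro x
    simp [f, LinearMap.BilinMap.toQuadraticMap_apply, Basis.equivFun_symm_apply,
      Finset.mul_sum]
    rw [Finset.sum_comm]
    refine Finset.sum_congr rfl fun i _ => Finset.sum_congr rfl fun j _ => ?_
    ring
  obtain ⟨p, hp⟩ := CharP.exists F
  have hd := char_dvd_card_solutions p hf
  have : Fintype.card {x // MvPolynomial.eval x f = 0} = 1 := by
    rw [Fintype.card_eq_one_iff]
    refine ⟨⟨0, by rw [he]; simp⟩, fun y => Subtype.ext ?_⟩
    exact (LinearEquiv.map_eq_zero_iff _).1 (hQ _ ((he y).symm.trans y.2))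
  rw [this, Nat.dvd_one] at hd
  exact CharP.char_ne_one F p hd

theorem card_mul_eq [DecidableEq F] (c : F) :
    Nat.card {p : F × F // p.1 * p.2 = c} + 1 =
      Nat.card F + (if c = 0 then Nat.card F else 0) := by
  have := Fintype.ofFinite F
  have hF : Nat.card {a : F // a ≠ 0} + 1 = Nat.card F := by
    rw [Nat.card_eq_fintype_card, Nat.card_eq_fintype_card, Fintype.card_subtype_compl]
    have := Fintype.card_pos (α := F)
    simp; omega
  split_ifs with h
  · subst h
    let e : {p : F × F // p.1 * p.2 = 0} ≃ F ⊕ {a : F // a ≠ 0} :=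
      { toFun := fun p => if h : p.1.1 = 0 then .inl p.1.2 else .inr ⟨p.1.1, h⟩
        invFun := Sum.elim (fun b => ⟨(0, b), by simp⟩) (fun a => ⟨(a.1, 0), by simp⟩)
        left_inv := by
          rintro ⟨⟨a, b⟩, hp⟩
          by_cases ha : a = 0
          · simp [ha]
          · simp only [mul_eq_zero, ha, false_or] at hp
            simp [ha, hp]
        right_inv := by
          rintro (b | a)
          · simp
          · simp [a.2] }
    rw [Nat.card_congr e, Nat.card_sum, add_assoc, hF]
  · let e : {p : F × F // p.1 * p.2 = c} ≃ {a : F // a ≠ 0} :=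
      { toFun := fun p => ⟨p.1.1, fun h0 => h (by rw [← p.2, h0, zero_mul])⟩
        invFun := fun a => ⟨(a.1, a.1⁻¹ * c), by field_simp [a.2]⟩
        left_inv := by
          rintro ⟨⟨a, b⟩, hp⟩
          have ha : a ≠ 0 := fun h0 => h (by rw [← hp]; simp [h0])
          simp only [Subtype.mk.injEq, Prod.mk.injEq, true_and]
          rw [← hp]; field_simp
        right_inv := fun a => rfl }
    rw [Nat.card_congr e, hF, add_zero]

/-- The zeros of a quadratic form with a hyperbolic pair, in terms of those on the complement. -/
theorem card_zeros_eq_of_hyperbolic_pair {Q : QuadraticForm F V} {x y : V}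
    (hx : Q x = 0) (hy : Q y = 0) (hxy : polar Q x y = 1) :
    Nat.card {v // Q v = 0} + Nat.card (pairPerp Q x y) =
      Nat.card F * Nat.card (pairPerp Q x y) +
        Nat.card F * Nat.card {u : pairPerp Q x y // Q u = 0} := by
  classical
  have := Module.finite_of_finite F (M := V)
  have := Fintype.ofFinite (pairPerp Q x y)
  let e : {v // Q v = 0} ≃ (u : pairPerp Q x y) × {p : F × F // p.1 * p.2 = -Q u} :=
    { toFun := fun v => ⟨((hyperbolicEquiv hx hy hxy).symm v).2.2,
        ⟨(((hyperbolicEquiv hx hy hxy).symm v).1, ((hyperbolicEquiv hx hy hxy).symm v).2.1), by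
          rw [eq_neg_iff_add_eq_zero, ← hyperbolicEquiv_apply hx hy hxy]
          simpa using v.2⟩⟩
      invFun := fun s => ⟨hyperbolicEquiv hx hy hxy (s.2.1.1, s.2.1.2, s.1), by
        rw [hyperbolicEquiv_apply, s.2.2]; simp⟩
      left_inv := fun v => by simp
      right_inv := fun s => by
        rcases s with ⟨u, ⟨⟨a, b⟩, hp⟩⟩
        refine Sigma.subtype_ext ?_ ?_ <;> simp }
  have hs : ∀ u : pairPerp Q x y, (if -Q u = 0 then Nat.card F else 0) =
      Nat.card F * if Q u = 0 then 1 else 0 := by intro u; simp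
  rw [Nat.card_congr e, Nat.card_sigma, Nat.card_eq_fintype_card (α := pairPerp Q x y),
    ← Finset.card_univ, Finset.card_eq_sum_ones, ← Finset.sum_add_distrib]
  simp_rw [card_mul_eq, hs]
  rw [Finset.sum_add_distrib, ← Finset.mul_sum, Finset.sum_const, smul_eq_mul, Finset.sum_const,
    smul_eq_mul, mul_one, mul_comm, Finset.sum_boole, Nat.card_eq_fintype_card
      (α := {u : pairPerp Q x y // Q u = 0}), Fintype.card_subtype]
  rfl

/-- The number of zeros of a quadratic form over a finite field, in terms of the dimension of
the space and of the radical. -/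
theorem card_zeros {V : Type*} [AddCommGroup V] [Module F V] [Module.Finite F V]
    (Q : QuadraticForm F V) :
    (Odd (finrank F V + finrank F Q.radical) →
      Nat.card F * Nat.card {v // Q v = 0} = Nat.card F ^ finrank F V) ∧
    (Even (finrank F V + finrank F Q.radical) → ∃ ε : ℤ, (ε = 1 ∨ ε = -1) ∧
      (Nat.card F : ℤ) * Nat.card {v // Q v = 0} = (Nat.card F : ℤ) ^ finrank F V +
        ε * (Nat.card F - 1) * (Nat.card F : ℤ) ^ ((finrank F V + finrank F Q.radical) / 2)) := by
  by_cases h : ∃ x, Q x = 0 ∧ x ∉ Q.radical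
  · obtain ⟨x, hx, hr⟩ := h
    obtain ⟨y, hy, hxy⟩ := exists_hyperbolic_pair hx hr
    have hfin : finrank F V = finrank F (pairPerp Q x y) + 2 := by
      rw [← (hyperbolicEquiv hx hy hxy).finrank_eq]
      simp; ring
    have hrad : finrank F Q.radical =
        finrank F (radical (Q.comp (pairPerp Q x y).subtype)) := by
      rw [radical_eq_map_pairPerp hx hy hxy, Submodule.finrank_map_subtype_eq]
    have hc := card_zeros_eq_of_hyperbolic_pair hx hy hxy
    have ih := card_zeros (Q.comp (pairPerp Q x y).subtype)
    simp only [comp_apply, Submodule.subtype_apply] at ih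
    rw [Module.natCard_eq_pow_finrank (K := F) (V := pairPerp Q x y)] at hc
    rw [hfin, hrad]
    generalize finrank F (pairPerp Q x y) = n at *
    generalize finrank F (radical (Q.comp (pairPerp Q x y).subtype)) = r at *
    have h2 : (n + 2 + r) / 2 = (n + r) / 2 + 1 := by omega
    rw [h2]
    have hc' : (Nat.card {v // Q v = 0} : ℤ) + (Nat.card F : ℤ) ^ n =
      Nat.card F * (Nat.card F : ℤ) ^ n +
        Nat.card F * Nat.card {u : pairPerp Q x y // Q u = 0} := by exact_mod_cast hc
    constructor
    · intro ho
      have := ih.1 (by grind)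
      zify at this ⊢
      rw [pow_add]
      linear_combination (Nat.card F : ℤ) * hc' + (Nat.card F : ℤ) * this
    · intro he
      obtain ⟨ε, hε, this⟩ := ih.2 (by grind)
      refine ⟨ε, hε, ?_⟩
      rw [pow_add, pow_succ]
      linear_combination (Nat.card F : ℤ) * hc' + (Nat.card F : ℤ) * this
  · push Not at h
    have hN : Nat.card {v // Q v = 0} = Nat.card F ^ finrank F Q.radical := by
      rw [← Module.natCard_eq_pow_finrank (K := F) (V := Q.radical)]
      exact Nat.card_congr (Equiv.subtypeEquivRight fun v => ⟨h v, fun hv => hv.1⟩)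
    -- Base case: all zeros lie in the radical, so a complement is anisotropic. Its dimension 0
    -- gives sign `1`, dimension 1 the odd case, dimension 2 sign `-1`.
    obtain ⟨U, hU⟩ := Submodule.exists_isCompl Q.radical
    have hfin := Submodule.finrank_add_eq_of_isCompl hU
    have hle : finrank F U ≤ 2 := by
      refine finrank_le_two_of_anisotropic (Q := Q.comp U.subtype) fun u hu => ?_
      have := h u hu
      have := hU.disjoint.le_bot ⟨this, u.2⟩
      simpa using this
    rw [hN, ← hfin]
    generalize finrank F Q.radical = r at *
    generalize finrank F U = n at *
    interval_cases n
    · refine ⟨fun ho => absurd ho (by grind), fun _ => ⟨1, .inl rfl, ?_⟩⟩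
      rw [show (r + 0 + r) / 2 = r by omega]
      push_cast; ring
    · refine ⟨fun _ => by ring, fun ho => absurd ho (by grind)⟩
    · refine ⟨fun ho => absurd ho (by grind), fun _ => ⟨-1, .inr rfl, ?_⟩⟩
      rw [show (r + 2 + r) / 2 = r + 1 by omega]
      push_cast; ring
termination_by finrank F V
decreasing_by omega

end Finite

/-! ### Double counting and divisibility tools. -/

theorem natCard_prod_subtype {α β : Type*} [Fintype α] [Finite β] (P : α → β → Prop) :
    Nat.card {p : α × β // P p.1 p.2} = ∑ a, Nat.card {b // P a b} := by
  rw [← Nat.card_sigma]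
  exact Nat.card_congr
    { toFun := fun p => ⟨p.1.1, p.1.2, p.2⟩
      invFun := fun s => ⟨(s.1, s.2.1), s.2.2⟩
      left_inv := fun _ => rfl
      right_inv := fun _ => rfl }

theorem sum_natCard_comm {α β : Type*} [Fintype α] [Fintype β] (P : α → β → Prop) :
    ∑ a, Nat.card {b // P a b} = ∑ b, Nat.card {a // P a b} := by
  rw [← natCard_prod_subtype, ← natCard_prod_subtype fun b a => P a b]
  exact Nat.card_congr ((Equiv.prodComm α β).subtypeEquiv fun p => Iff.rfl)

theorem sum_ite_mem_submodule {F V : Type*} [Field F] [Finite F] [AddCommGroup V] [Module F V]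
    [Fintype V] (S : Submodule F V) [DecidablePred (· ∈ S)] (a b : ℤ) :
    ∑ u : V, (if u ∈ S then a else b) =
      (Nat.card F : ℤ) ^ finrank F S * a +
        ((Nat.card F : ℤ) ^ finrank F V - (Nat.card F : ℤ) ^ finrank F S) * b := by
  have hS : ((Finset.univ.filter (· ∈ S)).card : ℤ) = (Nat.card F : ℤ) ^ finrank F S := by
    have := Module.natCard_eq_pow_finrank (K := F) (V := S)
    rw [← Fintype.card_subtype, ← Nat.card_eq_fintype_card]
    exact_mod_cast this
  have hV : (Fintype.card V : ℤ) = (Nat.card F : ℤ) ^ finrank F V := by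
    have := Module.natCard_eq_pow_finrank (K := F) (V := V)
    rw [← Nat.card_eq_fintype_card]
    exact_mod_cast this
  have hc : ((Finset.univ.filter (· ∈ S)).card : ℤ) +
      ((Finset.univ.filter (¬ · ∈ S)).card : ℤ) = Fintype.card V := by
    exact_mod_cast Finset.card_filter_add_card_filter_not (s := Finset.univ) (· ∈ S)
  rw [Finset.sum_ite, Finset.sum_const, Finset.sum_const, nsmul_eq_mul, nsmul_eq_mul]
  rw [hS, hV] at hc
  rw [hS]
  linear_combination b * hc

theorem le_of_pow_dvd_pow_mul {q x : ℤ} {a b : ℕ} (hq : 1 < q) (hx : IsCoprime q x)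
    (h : q ^ a ∣ q ^ b * x) : a ≤ b := by
  by_contra! hab
  obtain ⟨c, rfl⟩ := Nat.exists_eq_add_of_lt hab
  rw [add_assoc, pow_add] at h
  have h' := (mul_dvd_mul_iff_left (pow_ne_zero b (by omega))).1 h
  have h'' : q ∣ x := (dvd_pow_self q (by omega)).trans h'
  have := hx.isUnit_of_dvd' dvd_rfl h''
  rcases Int.isUnit_iff.1 this with h | h <;> omega

/-! ### Tangent spaces of a quadratic map and their annihilators. -/

section Tangent

variable {F V K : Type*} [Field F] [AddCommGroup V] [Module F V] [AddCommGroup K] [Module F K]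

/-- The space spanned by the value of a quadratic map at a point and by its polar map there. -/
def tangent (Q : QuadraticMap F V K) (v : V) : Submodule F K :=
  LinearMap.range ((LinearMap.toSpanSingleton F K (Q v)).coprod (Q.polarBilin v))

variable {Q : QuadraticMap F V K}

theorem mem_tangent {v : V} {z : K} :
    z ∈ tangent Q v ↔ ∃ (a : F) (w : V), a • Q v + polar Q v w = z := by
  simp [tangent]

/-- The generator `Q v` is needed in characteristic 2, where `polar Q v v = 0` and the radical still
demands that the form vanish at `v`. -/
theorem mem_dualAnnihilator_tangent {v : V} {c : Dual F K} :
    c ∈ (tangent Q v).dualAnnihilator ↔ v ∈ radical (c.compQuadraticMap Q) := by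
  rw [Submodule.mem_dualAnnihilator]
  have hp : ∀ w, polar (c.compQuadraticMap Q) v w = c (polar Q v w) := fun w => by
    simp [polar]
  constructor
  · intro h
    refine ⟨?_, ?_⟩
    · exact h _ (mem_tangent.2 ⟨1, 0, by simp⟩)
    · ext w
      rw [polarBilin_apply_apply, hp]
      exact h _ (mem_tangent.2 ⟨0, w, by simp⟩)
  · rintro ⟨h0, h⟩ z hz
    obtain ⟨a, w, rfl⟩ := mem_tangent.1 hz
    have h1 := DFunLike.congr_fun h w
    rw [polarBilin_apply_apply, hp] at h1
    have h0' : c (Q v) = 0 := h0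
    rw [map_add, map_smul, h0', h1]
    simp

/-- The source of the parametrization has dimension one more than `V`, and its kernel is the line of
`(-2, v)`, because `polar Q v v = 2 • Q v`. -/
theorem finrank_tangent [Module.Finite F V] {v : V} (hv : v ≠ 0) (h1 : Q v ≠ 0)
    (h2 : ∀ (a : F) (w : V), a • Q v + polar Q v w = 0 → w ∈ Submodule.span F {v}) :
    finrank F (tangent Q v) = finrank F V := by
  have hk : LinearMap.ker ((LinearMap.toSpanSingleton F K (Q v)).coprod (Q.polarBilin v)) =
      Submodule.span F {((-2 : F), v)} := by
    ext ⟨a, w⟩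
    rw [LinearMap.mem_ker, Submodule.mem_span_singleton]
    simp only [LinearMap.coprod_apply, LinearMap.toSpanSingleton_apply, polarBilin_apply_apply,
      Prod.smul_mk, Prod.mk.injEq]
    have hp : ∀ b : F, a • Q v + polar Q v (b • v) = (a + 2 * b) • Q v := fun b => by
      rw [polar_smul_right, polar_self, ← Nat.cast_smul_eq_nsmul F, smul_smul, ← add_smul]
      congr 1; push_cast; ring
    constructor
    · intro h
      obtain ⟨b, rfl⟩ := Submodule.mem_span_singleton.1 (h2 a w h)
      rw [hp] at h
      have := (smul_eq_zero.1 h).resolve_right h1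
      exact ⟨b, by rw [smul_eq_mul]; linear_combination -this, rfl⟩
    · rintro ⟨b, rfl, rfl⟩
      rw [hp]
      simp; left; ring
  have hn := LinearMap.finrank_range_add_finrank_ker
    ((LinearMap.toSpanSingleton F K (Q v)).coprod (Q.polarBilin v))
  rw [hk, finrank_span_singleton (by simp [hv]), finrank_prod, finrank_self] at hn
  rw [tangent]
  omega

theorem card_annihilator_tangent [Module.Finite F K] (v u : V) :
    Nat.card {c : Dual F K // v ∈ radical (c.compQuadraticMap Q) ∧ c (Q u) = 0} *
      Nat.card F ^ finrank F (tangent Q v ⊔ Submodule.span F {Q u} : Submodule F K) =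
      Nat.card F ^ finrank F K := by
  have he : Nat.card {c : Dual F K // v ∈ radical (c.compQuadraticMap Q) ∧ c (Q u) = 0} =
      Nat.card (tangent Q v ⊔ Submodule.span F {Q u} : Submodule F K).dualAnnihilator := by
    refine Nat.card_congr (Equiv.subtypeEquivRight fun c => ?_)
    rw [Submodule.dualAnnihilator_sup_eq, Submodule.mem_inf, mem_dualAnnihilator_tangent]
    refine and_congr_right fun _ => ?_
    rw [Submodule.mem_dualAnnihilator]
    constructor
    · intro h w hw
      obtain ⟨b, rfl⟩ := Submodule.mem_span_singleton.1 hw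
      simp [h]
    · exact fun h => h _ (Submodule.mem_span_singleton_self _)
  rw [he, Module.natCard_eq_pow_finrank (K := F), ← pow_add, add_comm,
    Subspace.finrank_add_finrank_dualAnnihilator_eq]

end Tangent

/-! ### Lower bounds on the dimension of the target. -/

section Bounds

variable {F V K : Type*} [Field F] [Finite F] [AddCommGroup V] [Module F V] [Module.Finite F V]
  [AddCommGroup K] [Module F K] [Module.Finite F K]

/-- The radical has positive dimension, so the error exponent in `card_zeros`, half of an even
number exceeding `finrank F V`, is at least `finrank F V / 2 + 1`. -/
theorem pow_dvd_card_zeros {Q : QuadraticForm F V} {v : V} (hv : v ≠ 0) (hr : v ∈ Q.radical)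
    (hV : 2 ≤ finrank F V) :
    (Nat.card F : ℤ) ^ (finrank F V / 2 + 1) ∣ (Nat.card F : ℤ) * Nat.card {v // Q v = 0} := by
  have hρ : 0 < finrank F Q.radical := by
    rw [Module.finrank_pos_iff_exists_ne_zero]
    exact ⟨⟨v, hr⟩, by simpa [Subtype.ext_iff] using hv⟩
  obtain ⟨ho, he⟩ := card_zeros Q
  rcases Nat.even_or_odd (finrank F V + finrank F Q.radical) with h | h
  · obtain ⟨ε, -, hε⟩ := he h
    rw [hε]
    refine dvd_add (pow_dvd_pow _ (by omega)) (Dvd.dvd.mul_left (pow_dvd_pow _ ?_) _)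
    have := Nat.even_iff.1 h
    omega
  · have := ho h
    rw [show (Nat.card F : ℤ) * Nat.card {v // Q v = 0} = (Nat.card F : ℤ) ^ finrank F V by
      exact_mod_cast this]
    exact pow_dvd_pow _ (by omega)

/-- In odd dimension the error term occurs only for an odd, hence nonzero, radical dimension; the
factor `Nat.card Q.radical` then gains one more power of `q`. -/
theorem pow_dvd_card_radical_mul_card_zeros (Q : QuadraticForm F V)
    (hV : 2 ≤ finrank F V) (hodd : Odd (finrank F V)) :
    (Nat.card F : ℤ) ^ (finrank F V / 2 + 2) ∣
      Nat.card Q.radical * ((Nat.card F : ℤ) * Nat.card {v // Q v = 0}) := by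
  have hcard : (Nat.card Q.radical : ℤ) = (Nat.card F : ℤ) ^ finrank F Q.radical := by
    exact_mod_cast Module.natCard_eq_pow_finrank (K := F) (V := Q.radical)
  rw [hcard]
  have hm := Nat.odd_iff.1 hodd
  obtain ⟨ho, he⟩ := card_zeros Q
  rcases Nat.even_or_odd (finrank F V + finrank F Q.radical) with h | h
  · obtain ⟨ε, -, hε⟩ := he h
    have := Nat.even_iff.1 h
    rw [hε, mul_add, ← pow_add, mul_left_comm, ← pow_add]
    exact dvd_add (pow_dvd_pow _ (by omega)) (Dvd.dvd.mul_left (pow_dvd_pow _ (by omega)) _)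
  · have := ho h
    rw [show (Nat.card F : ℤ) * Nat.card {v // Q v = 0} = (Nat.card F : ℤ) ^ finrank F V by
      exact_mod_cast this, ← pow_add]
    exact pow_dvd_pow _ (by omega)

section Sums

variable {F V K : Type*} [Field F] [Finite F] [AddCommGroup V] [Module F V]
  [AddCommGroup K] [Module F K] [Module.Finite F K] {Q : QuadraticMap F V K}

theorem card_mul_sum_annihilator_zero [Fintype V] (h1 : ∀ v, v ≠ 0 → Q v ≠ 0) :
    (Nat.card F : ℤ) * ∑ u : V, (Nat.card {c : Dual F K //
        (0 : V) ∈ radical (c.compQuadraticMap Q) ∧ c (Q u) = 0} : ℤ) =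
      (Nat.card F : ℤ) ^ finrank F K *
        ((Nat.card F : ℤ) + (Nat.card F : ℤ) ^ finrank F V - 1) := by
  classical
  have hq : (Nat.card F : ℤ) ≠ 0 := by exact_mod_cast Nat.card_pos.ne'
  have ht : tangent Q 0 = ⊥ := by
    rw [eq_bot_iff]
    intro z hz
    obtain ⟨a, w, rfl⟩ := mem_tangent.1 hz
    simp
  rw [Finset.mul_sum]
  have hterm : ∀ u : V, (Nat.card F : ℤ) * (Nat.card {c : Dual F K //
      (0 : V) ∈ radical (c.compQuadraticMap Q) ∧ c (Q u) = 0} : ℤ) =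
      if u ∈ (⊥ : Submodule F V) then (Nat.card F : ℤ) * (Nat.card F : ℤ) ^ finrank F K
      else (Nat.card F : ℤ) ^ finrank F K := by
    intro u
    have hc := card_annihilator_tangent (Q := Q) 0 u
    rw [ht, bot_sup_eq] at hc
    zify at hc
    split_ifs with hu
    · rw [(Submodule.mem_bot F).1 hu, QuadraticMap.map_zero, Submodule.span_zero_singleton,
        finrank_bot, pow_zero, mul_one] at hc
      rw [(Submodule.mem_bot F).1 hu, QuadraticMap.map_zero, hc]
    · rw [finrank_span_singleton (h1 u (by simpa using hu)), pow_one] at hc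
      rw [← hc, mul_comm]
  rw [Finset.sum_congr rfl fun u _ => hterm u, sum_ite_mem_submodule, finrank_bot]
  ring

theorem card_mul_sum_annihilator [Fintype V] {v : V} {r : ℕ} (hv : v ≠ 0)
    (hK : finrank F K = finrank F V + r)
    (ht : finrank F (tangent Q v) = finrank F V)
    (h3 : ∀ u, u ∉ Submodule.span F {v} → Q u ∉ tangent Q v) (hV : 2 ≤ finrank F V) :
    (Nat.card F : ℤ) * ∑ u : V, (Nat.card {c : Dual F K //
        v ∈ radical (c.compQuadraticMap Q) ∧ c (Q u) = 0} : ℤ) =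
      (Nat.card F : ℤ) ^ (r + 1) *
        ((Nat.card F : ℤ) + (Nat.card F : ℤ) ^ (finrank F V - 1) - 1) := by
  classical
  have hq : (Nat.card F : ℤ) ≠ 0 := by exact_mod_cast Nat.card_pos.ne'
  rw [Finset.mul_sum]
  have hterm : ∀ u : V, (Nat.card F : ℤ) * (Nat.card {c : Dual F K //
      v ∈ radical (c.compQuadraticMap Q) ∧ c (Q u) = 0} : ℤ) =
      if u ∈ Submodule.span F {v} then (Nat.card F : ℤ) * (Nat.card F : ℤ) ^ r
      else (Nat.card F : ℤ) ^ r := by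
    intro u
    have hc := card_annihilator_tangent (Q := Q) v u
    zify at hc
    rw [hK, pow_add] at hc
    split_ifs with hu
    · have : Q u ∈ tangent Q v := by
        obtain ⟨b, rfl⟩ := Submodule.mem_span_singleton.1 hu
        rw [QuadraticMap.map_smul]
        exact mem_tangent.2 ⟨b * b, 0, by simp⟩
      rw [sup_eq_left.2 ((Submodule.span_singleton_le_iff_mem _ _).2 this), ht] at hc
      rw [mul_right_inj' hq]
      exact mul_right_cancel₀ (pow_ne_zero _ hq) (hc.trans (mul_comm _ _))
    · have hne := h3 u hu
      rw [Submodule.finrank_sup_span_singleton hne, ht, pow_succ] at hc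
      refine mul_right_cancel₀ (pow_ne_zero (finrank F V) hq) ?_
      linear_combination hc
  rw [Finset.sum_congr rfl fun u _ => hterm u, sum_ite_mem_submodule, finrank_span_singleton hv]
  obtain ⟨n, hn⟩ := Nat.exists_eq_add_of_le hV
  rw [hn, show 2 + n - 1 = n + 1 by omega, show 2 + n = n + 1 + 1 by omega]
  ring

end Sums

variable {Q : QuadraticMap F V K}

/-- If no value of a quadratic map away from a line lies in the tangent space at that line, and
tangent spaces have full dimension, then the target has dimension at least `3 / 2` times that of
the source. -/
theorem three_mul_finrank_le (hV : 2 ≤ finrank F V) (h1 : ∀ v, v ≠ 0 → Q v ≠ 0)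
    (ht : ∀ v, v ≠ 0 → finrank F (tangent Q v) = finrank F V)
    (h3 : ∀ v, v ≠ 0 → ∀ u, u ∉ Submodule.span F {v} → Q u ∉ tangent Q v) :
    3 * finrank F V ≤ 2 * finrank F K := by
  classical
  have := Module.finite_of_finite F (M := V)
  have := Fintype.ofFinite V
  have := Module.finite_of_finite F (M := Dual F K)
  have := Fintype.ofFinite (Dual F K)
  have := Module.nontrivial_of_finrank_pos (R := F) (M := V) (by omega)
  obtain ⟨v, hv⟩ := exists_ne (0 : V)
  obtain ⟨r, hr⟩ : ∃ r, finrank F K = finrank F V + r :=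
    Nat.exists_eq_add_of_le (ht v hv ▸ Submodule.finrank_le _)
  have hq : (1 : ℤ) < Nat.card F := by exact_mod_cast Finite.one_lt_card
  have hcop : ∀ x : ℤ, (Nat.card F : ℤ) ∣ x → IsCoprime (Nat.card F : ℤ) (x - 1) := by
    rintro x ⟨y, rfl⟩
    exact ⟨y, -1, by ring⟩
  have hpow : ∀ n, 0 < n → (Nat.card F : ℤ) ∣ (Nat.card F : ℤ) ^ n := fun n hn =>
    dvd_pow_self _ hn.ne'
  -- For one fixed `v`, the count is `q ^ (r + 1)` times an integer coprime to `q`, while each `c`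
  -- contributes a multiple of `q ^ (finrank F V / 2 + 1)`.
  have hle : finrank F V / 2 ≤ r := by
    have hs := card_mul_sum_annihilator hv hr (ht v hv) (h3 v hv) hV
    rw [← Nat.cast_sum, ← sum_natCard_comm fun (c : Dual F K) (u : V) =>
      v ∈ radical (c.compQuadraticMap Q) ∧ c (Q u) = 0, Nat.cast_sum, Finset.mul_sum] at hs
    have hd : (Nat.card F : ℤ) ^ (finrank F V / 2 + 1) ∣ (Nat.card F : ℤ) ^ (r + 1) *
        ((Nat.card F : ℤ) + (Nat.card F : ℤ) ^ (finrank F V - 1) - 1) := by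
      rw [← hs]
      refine Finset.dvd_sum fun c _ => ?_
      by_cases hc : v ∈ radical (c.compQuadraticMap Q)
      · simp only [hc, true_and]
        exact pow_dvd_card_zeros hv hc hV
      · simp [hc]
    have := le_of_pow_dvd_pow_mul hq (hcop _ (dvd_add dvd_rfl (hpow _ (by omega)))) hd
    omega
  rcases Nat.even_or_odd (finrank F V) with he | ho
  · have := Nat.even_iff.1 he
    omega
  -- The bound `hle` rounds down, so odd dimension needs one more power of `q`; it comes from
  -- summing over all `v`, which weights each `c` by the size of its radical.
  · have hsum : ∑ v : V, (Nat.card F : ℤ) * ∑ u : V, (Nat.card {c : Dual F K //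
        v ∈ radical (c.compQuadraticMap Q) ∧ c (Q u) = 0} : ℤ) =
        ∑ c : Dual F K, (Nat.card (radical (c.compQuadraticMap Q)) : ℤ) *
          ((Nat.card F : ℤ) * Nat.card {u // c.compQuadraticMap Q u = 0}) := by
      rw [← Finset.mul_sum]
      simp_rw [mul_left_comm _ (Nat.card F : ℤ)]
      rw [← Finset.mul_sum]
      congr 1
      norm_cast
      simp_rw [← sum_natCard_comm fun (c : Dual F K) (u : V) =>
        _ ∈ radical (c.compQuadraticMap Q) ∧ c (Q u) = 0]
      rw [Finset.sum_comm]
      refine Finset.sum_congr rfl fun c _ => ?_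
      rw [← natCard_prod_subtype fun v u =>
        v ∈ radical (c.compQuadraticMap Q) ∧ c (Q u) = 0, ← Nat.card_prod]
      exact Nat.card_congr (Equiv.subtypeProdEquivProd (p := (· ∈ radical (c.compQuadraticMap Q)))
        (q := fun u => c (Q u) = 0))
    have hm := Nat.odd_iff.1 ho
    have hd : (Nat.card F : ℤ) ^ (finrank F V / 2 + 2) ∣ ∑ v : V, (Nat.card F : ℤ) * ∑ u : V,
        (Nat.card {c : Dual F K //
          v ∈ radical (c.compQuadraticMap Q) ∧ c (Q u) = 0} : ℤ) := by
      rw [hsum]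
      exact Finset.dvd_sum fun c _ => pow_dvd_card_radical_mul_card_zeros _ hV ho
    have hval : ∑ v : V, (Nat.card F : ℤ) * ∑ u : V,
        (Nat.card {c : Dual F K //
          v ∈ radical (c.compQuadraticMap Q) ∧ c (Q u) = 0} : ℤ) =
        ∑ v : V, if v ∈ (⊥ : Submodule F V) then (Nat.card F : ℤ) ^ finrank F K *
          ((Nat.card F : ℤ) + (Nat.card F : ℤ) ^ finrank F V - 1) else
          (Nat.card F : ℤ) ^ (r + 1) *
            ((Nat.card F : ℤ) + (Nat.card F : ℤ) ^ (finrank F V - 1) - 1) := by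
      refine Finset.sum_congr rfl fun v _ => ?_
      split_ifs with hv
      · rw [(Submodule.mem_bot F).1 hv]
        exact card_mul_sum_annihilator_zero h1
      · have hv : v ≠ 0 := by simpa using hv
        exact card_mul_sum_annihilator hv hr (ht v hv) (h3 v hv) hV
    rw [hval, sum_ite_mem_submodule, finrank_bot, pow_zero, hr] at hd
    obtain ⟨n, hn⟩ := Nat.exists_eq_add_of_le hV
    have hfac : (1 : ℤ) * ((Nat.card F : ℤ) ^ (finrank F V + r) *
        ((Nat.card F : ℤ) + (Nat.card F : ℤ) ^ finrank F V - 1)) +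
        ((Nat.card F : ℤ) ^ finrank F V - 1) * ((Nat.card F : ℤ) ^ (r + 1) *
            ((Nat.card F : ℤ) + (Nat.card F : ℤ) ^ (finrank F V - 1) - 1)) =
        (Nat.card F : ℤ) ^ (r + 1) * -((Nat.card F : ℤ) * (1 - (Nat.card F : ℤ) ^ n *
          ((Nat.card F : ℤ) + (Nat.card F : ℤ) ^ (n + 2) - 1) + (Nat.card F : ℤ) ^ n
          - (Nat.card F : ℤ) ^ (n + 1) *
            ((Nat.card F : ℤ) + (Nat.card F : ℤ) ^ (n + 1) - 1)) - 1) := by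
      rw [hn, show 2 + n - 1 = n + 1 by omega]
      ring
    rw [hfac] at hd
    have := le_of_pow_dvd_pow_mul hq (hcop _ (Dvd.intro _ rfl)).neg_right hd
    omega

end Bounds

/-! ### The equal-dimension case in even dimension. -/

/-- There is no quadratic map between spaces of the same positive even dimension that has full
tangent spaces and is bijective after rescaling of its values. -/
theorem not_injective_rescaling {F V K : Type*} [Field F] [Finite F] [AddCommGroup V] [Module F V]
    [Module.Finite F V] [AddCommGroup K] [Module F K] [Module.Finite F K] {Q : QuadraticMap F V K}
    (hpos : 0 < finrank F V) (heven : Even (finrank F V)) (hK : finrank F K = finrank F V)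
    (ht : ∀ v, v ≠ 0 → finrank F (tangent Q v) = finrank F V) {ψ : V → K}
    (hψ : ∀ v, ∃ a : F, a ≠ 0 ∧ ψ v = a • Q v) : ¬ Function.Injective ψ := by
  classical
  intro hinj
  have := Module.finite_of_finite F (M := V)
  have := Module.finite_of_finite F (M := K)
  have hcard : Nat.card V = Nat.card K := by
    rw [Module.natCard_eq_pow_finrank (K := F), Module.natCard_eq_pow_finrank (K := F) (V := K), hK]
  have hbij : Function.Bijective ψ := (Nat.bijective_iff_injective_and_card ψ).2 ⟨hinj, hcard⟩
  have := Module.nontrivial_of_finrank_pos (R := F) (M := K) (by omega)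
  obtain ⟨c, hc⟩ := exists_ne (0 : Dual F K)
  have hrad : radical (c.compQuadraticMap Q) = ⊥ := by
    rw [eq_bot_iff]
    intro v hv
    by_contra hv0
    have hv0 : v ≠ 0 := by simpa using hv0
    have htop : tangent Q v = ⊤ := Submodule.eq_top_of_finrank_eq (by rw [ht v hv0, hK])
    have := mem_dualAnnihilator_tangent.2 hv
    rw [htop, Submodule.dualAnnihilator_top] at this
    exact hc ((Submodule.mem_bot F).1 this)
  have hN : Nat.card F * Nat.card {v // c.compQuadraticMap Q v = 0} =
      Nat.card F ^ finrank F V := by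
    -- Rescaling by nonzero scalars does not change where `c` vanishes, so the zeros of `c ∘ Q`
    -- correspond to the hyperplane `ker c`.
    have e : {v // c.compQuadraticMap Q v = 0} ≃ LinearMap.ker c :=
      (Equiv.ofBijective ψ hbij).subtypeEquiv fun v => by
        obtain ⟨a, ha, h⟩ := hψ v
        rw [Equiv.ofBijective_apply, LinearMap.mem_ker, h, map_smul, smul_eq_zero]
        simp [ha]
    rw [Nat.card_congr e, Module.natCard_eq_pow_finrank (K := F) (V := LinearMap.ker c), ← pow_succ', ← hK,
      Module.Dual.finrank_ker_add_one_of_ne_zero hc]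
  obtain ⟨ε, hε, h⟩ := (card_zeros (c.compQuadraticMap Q)).2 (by rw [hrad]; simpa using heven)
  have hq : (1 : ℤ) < Nat.card F := by exact_mod_cast Finite.one_lt_card
  rw [show (Nat.card F : ℤ) * Nat.card {v // c.compQuadraticMap Q v = 0} =
      (Nat.card F : ℤ) ^ finrank F V by exact_mod_cast hN, left_eq_add] at h
  rcases mul_eq_zero.1 h with h | h
  · rcases mul_eq_zero.1 h with h | h
    · rcases hε with rfl | rfl <;> omega
    · omega
  · exact pow_ne_zero _ (by omega) h

end QuadraticMap

/-! ### The Veronese map modulo a code. -/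

namespace SymRank

open Matrix Module

variable {F : Type*} [Field F] {m : ℕ}

theorem matrix_rank_add_le (A B : Matrix (Fin m) (Fin m) F) :
    (A + B).rank ≤ A.rank + B.rank := by
  rw [rank, rank, rank, mulVecLin_add]
  exact (Submodule.finrank_mono (LinearMap.range_add_le _ _)).trans
    (Submodule.finrank_add_le_finrank_add_finrank _ _)

theorem mem_symMat {A : Matrix (Fin m) (Fin m) F} : A ∈ SymMat F m ↔ A.IsSymm := Iff.rfl

/-- The quadratic map `v ↦ v vᵀ` with values in the symmetric matrices. -/
def veronese (F : Type*) [Field F] (m : ℕ) : QuadraticMap F (Fin m → F) (SymMat F m) :=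
  QuadraticMap.ofPolar (fun v => ⟨vecMulVec v v, by
      rw [mem_symMat, IsSymm, transpose_vecMulVec]⟩)
    (fun a v => by ext i j; simp [vecMulVec_apply]; ring)
    (fun u v w => by ext i j; simp [QuadraticMap.polar, vecMulVec_apply]; ring)
    (fun a v w => by ext i j; simp [QuadraticMap.polar, vecMulVec_apply]; ring)

theorem coe_veronese (v : Fin m → F) :
    (veronese F m v : Matrix (Fin m) (Fin m) F) = vecMulVec v v := rfl

theorem coe_polar_veronese (v w : Fin m → F) :
    ((QuadraticMap.polar (veronese F m) v w : SymMat F m) : Matrix (Fin m) (Fin m) F) =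
      vecMulVec v w + vecMulVec w v := by
  ext i j
  simp [QuadraticMap.polar, coe_veronese, vecMulVec_apply]
  ring

theorem coe_tangent_veronese (a : F) (v w : Fin m → F) :
    ((a • veronese F m v + QuadraticMap.polar (veronese F m) v w : SymMat F m) :
      Matrix (Fin m) (Fin m) F) = vecMulVec v (a • v + w) + vecMulVec w v := by
  ext i j
  simp [coe_veronese, coe_polar_veronese, vecMulVec_apply]
  ring

theorem rank_tangent_veronese_le (a : F) (v w : Fin m → F) :
    ((a • veronese F m v + QuadraticMap.polar (veronese F m) v w : SymMat F m) :
      Matrix (Fin m) (Fin m) F).rank ≤ 2 := by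
  rw [coe_tangent_veronese]
  exact (matrix_rank_add_le _ _).trans (add_le_add (rank_vecMulVec_le _ _) (rank_vecMulVec_le _ _))

theorem eq_zero_of_mem {C : SymCode F m} {A : SymMat F m} (hA : A ∈ C)
    (hr : (A : Matrix (Fin m) (Fin m) F).rank < minDist C) : A = 0 := by
  by_contra hne
  have : minDist C ≤ (A : Matrix (Fin m) (Fin m) F).rank :=
    Nat.sInf_le ⟨A, hA, 0, C.zero_mem, hne, by simp [rankDist]⟩
  omega

/-- The Veronese map modulo a code. -/
def veroneseMod (C : SymCode F m) : QuadraticMap F (Fin m → F) (SymMat F m ⧸ C) :=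
  C.mkQ.compQuadraticMap (veronese F m)

theorem veroneseMod_apply (C : SymCode F m) (v : Fin m → F) :
    veroneseMod C v = C.mkQ (veronese F m v) := rfl

theorem polar_veroneseMod (C : SymCode F m) (v w : Fin m → F) :
    QuadraticMap.polar (veroneseMod C) v w = C.mkQ (QuadraticMap.polar (veronese F m) v w) := by
  simp [QuadraticMap.polar, veroneseMod_apply]

theorem veronese_ne_zero {v : Fin m → F} (hv : v ≠ 0) : veronese F m v ≠ 0 := by
  obtain ⟨i, hi⟩ := Function.ne_iff.1 hv
  intro h
  have := congrFun (congrFun (congrArg Subtype.val h) i) i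
  rw [coe_veronese, vecMulVec_apply] at this
  exact hi (by simpa using this)

variable {C : SymCode F m}

theorem veroneseMod_ne_zero (hC : 2 ≤ minDist C) {v : Fin m → F} (hv : v ≠ 0) :
    veroneseMod C v ≠ 0 := by
  intro h
  rw [veroneseMod_apply, Submodule.mkQ_apply, Submodule.Quotient.mk_eq_zero] at h
  refine veronese_ne_zero hv (eq_zero_of_mem h (lt_of_le_of_lt ?_ hC))
  exact rank_vecMulVec_le _ _

theorem finrank_tangent_veroneseMod (hC : 3 ≤ minDist C) {v : Fin m → F} (hv : v ≠ 0) :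
    finrank F (QuadraticMap.tangent (veroneseMod C) v) = m := by
  rw [QuadraticMap.finrank_tangent hv (veroneseMod_ne_zero (by omega) hv), finrank_fin_fun]
  intro a w h
  rw [polar_veroneseMod, veroneseMod_apply, ← map_smul, ← map_add, Submodule.mkQ_apply,
    Submodule.Quotient.mk_eq_zero] at h
  have h0 := congrArg Subtype.val (eq_zero_of_mem h
    (lt_of_le_of_lt (rank_tangent_veronese_le a v w) hC))
  rw [coe_tangent_veronese] at h0
  obtain ⟨i, hi⟩ := Function.ne_iff.1 hv
  simp only [Pi.zero_apply] at hi
  refine Submodule.mem_span_singleton.2 ⟨-(a + w i / v i), ?_⟩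
  ext j
  have := congrFun (congrFun h0 i) j
  simp [vecMulVec_apply] at this
  simp only [Pi.smul_apply, smul_eq_mul]
  field_simp
  linear_combination -this

theorem veroneseMod_not_mem_tangent (hC : 4 ≤ minDist C) {v u : Fin m → F} (hv : v ≠ 0)
    (hu : u ∉ Submodule.span F {v}) :
    veroneseMod C u ∉ QuadraticMap.tangent (veroneseMod C) v := by
  intro h
  obtain ⟨a, w, h⟩ := QuadraticMap.mem_tangent.1 h
  rw [polar_veroneseMod, veroneseMod_apply, veroneseMod_apply, ← map_smul, ← map_add,
    ← sub_eq_zero, ← map_sub, Submodule.mkQ_apply, Submodule.Quotient.mk_eq_zero] at h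
  have h0 := eq_zero_of_mem h (lt_of_le_of_lt (b := 3) (by
    rw [Submodule.coe_sub, sub_eq_add_neg]
    refine (matrix_rank_add_le _ _).trans (add_le_add (b := 2) (d := 1) (rank_tangent_veronese_le a v w) ?_)
    rw [coe_veronese, ← neg_vecMulVec]
    exact rank_vecMulVec_le _ _) hC)
  have h0 := congrArg Subtype.val (sub_eq_zero.1 h0)
  rw [coe_tangent_veronese, coe_veronese] at h0
  obtain ⟨i, hi⟩ := Function.ne_iff.1 hv
  simp only [Pi.zero_apply] at hi
  refine hu (Submodule.mem_span_singleton.2 ⟨u i / v i, ?_⟩)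
  ext j
  have e1 := congrFun (congrFun h0 i) i
  have e2 := congrFun (congrFun h0 i) j
  have e3 := congrFun (congrFun h0 j) j
  simp [vecMulVec_apply] at e1 e2 e3
  -- Evaluate both matrices as quadratic forms at `v j • e_i - v i • e_j`: this vector is orthogonal
  -- to `v`, so the tangent side vanishes.
  have : (u i * v j - u j * v i) ^ 2 = 0 := by
    linear_combination 2 * v i * v j * e2 - v j ^ 2 * e1 - v i ^ 2 * e3
  have := pow_eq_zero_iff (two_ne_zero) |>.1 this
  simp only [Pi.smul_apply, smul_eq_mul]
  field_simp
  linear_combination this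

/-! ### Parametrizing the symmetric matrices of rank at most one. -/

/-- A vector `v` scaled to a symmetric matrix of rank at most one, with a row equal to `v`. -/
noncomputable def rankOne [NeZero m] (v : Fin m → F) : SymMat F m :=
  (v (Classical.epsilon fun i => v i ≠ 0))⁻¹ • veronese F m v

variable [NeZero m]

theorem epsilon_ne_zero {v : Fin m → F} (hv : v ≠ 0) :
    v (Classical.epsilon fun i => v i ≠ 0) ≠ 0 :=
  Classical.epsilon_spec (p := fun i => v i ≠ 0) (Function.ne_iff.1 hv)

theorem coe_rankOne_apply (v : Fin m → F) (i j : Fin m) :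
    (rankOne v : Matrix (Fin m) (Fin m) F) i j =
      (v (Classical.epsilon fun i => v i ≠ 0))⁻¹ * (v i * v j) := by
  simp [rankOne, coe_veronese, vecMulVec_apply]

theorem rankOne_diag_ne_zero_iff (v : Fin m → F) (i : Fin m) :
    (rankOne v : Matrix (Fin m) (Fin m) F) i i ≠ 0 ↔ v i ≠ 0 := by
  by_cases hv : v = 0
  · simp [hv, coe_rankOne_apply]
  · simp [coe_rankOne_apply, epsilon_ne_zero hv]

theorem rankOne_injective : Function.Injective (rankOne : (Fin m → F) → SymMat F m) := by
  intro v w h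
  -- The diagonal determines the support, and the pivot chosen by `Classical.epsilon` depends only
  -- on the support; the pivot row then recovers the vector.
  have hp : (fun i => v i ≠ 0) = fun i => w i ≠ 0 := by
    ext i
    rw [← rankOne_diag_ne_zero_iff, h, rankOne_diag_ne_zero_iff]
  by_cases hv : v = 0
  · ext i
    have := congrFun hp i
    simp [hv] at this
    simp [hv, this]
  · have hw : w ≠ 0 := by
      rintro rfl
      obtain ⟨i, hi⟩ := Function.ne_iff.1 hv
      have := congrFun hp i
      simp at this
      exact hi this
    have hv' := epsilon_ne_zero hv
    have hw' := epsilon_ne_zero hw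
    ext j
    have e := congrFun (congrFun (congrArg Subtype.val h)
      (Classical.epsilon fun i => v i ≠ 0)) j
    rw [coe_rankOne_apply, coe_rankOne_apply, inv_mul_cancel_left₀ hv'] at e
    rw [e, hp, inv_mul_cancel_left₀ hw']

theorem rank_rankOne_le (v : Fin m → F) : (rankOne v : Matrix (Fin m) (Fin m) F).rank ≤ 1 := by
  rw [rankOne, Submodule.coe_smul, coe_veronese, ← smul_vecMulVec]
  exact rank_vecMulVec_le _ _

theorem exists_rankOne_eq {A : SymMat F m} (hA : (A : Matrix (Fin m) (Fin m) F).rank ≤ 1) :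
    ∃ v, rankOne v = A := by
  rw [rank_eq_finrank_span_cols, finrank_le_one_iff] at hA
  obtain ⟨⟨a, _⟩, ha⟩ := hA
  have hcol : ∀ j, ∃ c : F, ∀ i, (A : Matrix (Fin m) (Fin m) F) i j = c * a i := by
    intro j
    obtain ⟨c, hc⟩ := ha ⟨_, Submodule.subset_span ⟨j, rfl⟩⟩
    refine ⟨c, fun i => ?_⟩
    exact (congrFun (congrArg Subtype.val hc) i).symm
  choose b hb using hcol
  have hs : ∀ i j, (A : Matrix (Fin m) (Fin m) F) i j = (A : Matrix (Fin m) (Fin m) F) j i :=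
    fun i j => A.2.apply j i
  by_cases h0 : A = 0
  · exact ⟨0, by rw [h0]; ext i j; simp [coe_rankOne_apply]⟩
  obtain ⟨i, j, hij⟩ : ∃ i j, (A : Matrix (Fin m) (Fin m) F) i j ≠ 0 := by
    by_contra! h
    exact h0 (by ext i j; simpa using h i j)
  have hbj : b j ≠ 0 := fun h => hij (by rw [hb, h, zero_mul])
  have hai : a i ≠ 0 := fun h => hij (by rw [hb, h, mul_zero])
  have hbi : b i ≠ 0 := fun h => hij (by rw [hs, hb, h, zero_mul])
  have hba : ∀ k, b k = b i / a i * a k := fun k => by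
    have := hs i k
    rw [hb, hb] at this
    field_simp
    linear_combination this
  set l := b i / a i with hl
  have hl0 : l ≠ 0 := div_ne_zero hbi hai
  have hane : a ≠ 0 := fun h => hai (by rw [h]; rfl)
  have hp := epsilon_ne_zero hane
  set p := Classical.epsilon fun i => a i ≠ 0 with hpdef
  have hsupp : (fun k => ((l * a p) • a) k ≠ 0) = fun k => a k ≠ 0 := by
    ext k
    simp [hl0, hp]
  -- Here `A = l • a aᵀ`. Scaling `a` by `s` scales `rankOne a`, which is `(a p)⁻¹ • a aᵀ`, by `s`,
  -- so `s = l * a p`.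
  refine ⟨(l * a p) • a, ?_⟩
  ext s t
  rw [coe_rankOne_apply, hsupp, ← hpdef, hb, hba]
  simp only [Pi.smul_apply, smul_eq_mul]
  field_simp

theorem ballSize_one_le [Finite F] : ballSize F m 1 ≤ Nat.card F ^ m := by
  have hsub : ball (0 : SymMat F m) 1 ⊆ Set.range (rankOne : (Fin m → F) → SymMat F m) := by
    intro A hA
    rw [mem_ball, rankDist] at hA
    refine exists_rankOne_eq (le_trans ?_ hA)
    have := rank_mul_le_right (-1 : Matrix (Fin m) (Fin m) F) (-(A : Matrix (Fin m) (Fin m) F))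
    simpa using this
  calc ballSize F m 1 ≤ (Set.range (rankOne : (Fin m → F) → SymMat F m)).ncard :=
        Set.ncard_le_ncard hsub (Set.finite_range _)
    _ = Nat.card F ^ m := by
        rw [← Set.image_univ, Set.ncard_image_of_injective _ rankOne_injective, Set.ncard_univ,
          Nat.card_fun, Nat.card_fin]

theorem mkQ_rankOne_injective (hC : 3 ≤ minDist C) :
    Function.Injective fun v : Fin m → F => C.mkQ (rankOne v) := by
  intro v w h
  rw [← sub_eq_zero] at h
  simp only [← map_sub] at h
  rw [Submodule.mkQ_apply, Submodule.Quotient.mk_eq_zero] at h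
  refine rankOne_injective (sub_eq_zero.1 (eq_zero_of_mem h (lt_of_le_of_lt (b := 2) ?_ hC)))
  rw [Submodule.coe_sub, sub_eq_add_neg]
  refine (matrix_rank_add_le _ _).trans (add_le_add (b := 1) (d := 1) (rank_rankOne_le v) ?_)
  rw [rankOne, Submodule.coe_smul, coe_veronese, ← smul_vecMulVec, ← neg_vecMulVec]
  exact rank_vecMulVec_le _ _

end SymRank

/-! ### From codimension to covering density. -/

namespace SymRank

open Matrix Module

variable {F : Type*} [Field F] {m : ℕ}

/-- Symmetric matrices are functions on unordered pairs of indices. -/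
def symMatEquiv (F : Type*) [Field F] (m : ℕ) : SymMat F m ≃ (Sym2 (Fin m) → F) where
  toFun A := Sym2.lift ⟨fun i j => (A : Matrix (Fin m) (Fin m) F) i j, fun i j => A.2.apply j i⟩
  invFun f := ⟨of fun i j => f s(i, j), by
    rw [mem_symMat]
    ext i j
    simp [Sym2.eq_swap]⟩
  left_inv A := by ext i j; simp
  right_inv f := by
    ext s
    induction s using Sym2.ind
    simp

theorem natCard_symMat (F : Type*) [Field F] [Finite F] (m : ℕ) :
    Nat.card (SymMat F m) = Nat.card F ^ ((m ^ 2 + m) / 2) := by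
  rw [Nat.card_congr (symMatEquiv F m), Nat.card_fun, Nat.card_eq_fintype_card (α := Sym2 (Fin m)),
    Sym2.card, Fintype.card_fin, Nat.choose_two_right]
  congr 2
  rw [Nat.add_sub_cancel]
  ring

theorem minDist_le (C : SymCode F m) : minDist C ≤ m := by
  rcases Set.eq_empty_or_nonempty
    {k : ℕ | ∃ A ∈ C, ∃ B ∈ C, A ≠ B ∧ rankDist A B = k} with h | h
  · rw [minDist, h, Nat.sInf_empty]
    exact Nat.zero_le m
  · obtain ⟨A, -, B, -, -, hk⟩ := Nat.sInf_mem h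
    rw [minDist, ← hk]
    exact rank_le_width _

theorem coveringDensity_nonneg (C : SymCode F m) : 0 ≤ coveringDensity C := by
  unfold coveringDensity
  positivity

variable [Finite F] {C : SymCode F m}

theorem coveringDensity_mul_le (ht : (minDist C - 1) / 2 = 1) :
    coveringDensity C * (Nat.card F : ℝ) ^ finrank F (SymMat F m ⧸ C) ≤ (Nat.card F : ℝ) ^ m := by
  have := minDist_le C
  have : NeZero m := ⟨by omega⟩
  have hq : (0 : ℝ) < Nat.card F := by exact_mod_cast Nat.card_pos
  have hcard : (Nat.card C : ℝ) * (Nat.card F : ℝ) ^ finrank F (SymMat F m ⧸ C) =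
      (Nat.card F : ℝ) ^ ((m ^ 2 + m) / 2) := by
    rw [← Nat.cast_pow, ← Nat.cast_pow, ← natCard_symMat, ← Module.natCard_eq_pow_finrank,
      Submodule.card_eq_card_quotient_mul_card C]
    push_cast; ring
  have hb : (ballSize F m 1 : ℝ) ≤ (Nat.card F : ℝ) ^ m := by exact_mod_cast ballSize_one_le
  rw [coveringDensity, ht, div_mul_eq_mul_div, div_le_iff₀ (by positivity), mul_right_comm, hcard,
    mul_comm]
  gcongr

theorem lt_finrank_quotient_of_even (hC : 3 ≤ minDist C) (hm : Even m) :
    m < finrank F (SymMat F m ⧸ C) := by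
  have := minDist_le C
  have : NeZero m := ⟨by omega⟩
  obtain ⟨v, hv⟩ := exists_ne (0 : Fin m → F)
  have hle : m ≤ finrank F (SymMat F m ⧸ C) :=
    (finrank_tangent_veroneseMod hC hv).symm.le.trans (Submodule.finrank_le _)
  refine lt_of_le_of_ne hle fun heq => ?_
  refine QuadraticMap.not_injective_rescaling (Q := veroneseMod C) (by simp; omega) (by simpa)
    (by simpa using heq.symm) (fun v hv => by simpa using finrank_tangent_veroneseMod hC hv)
    (fun v => ?_) (mkQ_rankOne_injective hC)
  by_cases hv : v = 0
  · exact ⟨1, one_ne_zero, by simp [hv, rankOne]⟩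
  · exact ⟨_, inv_ne_zero (epsilon_ne_zero hv), by rw [rankOne, map_smul]; rfl⟩

theorem three_mul_le_finrank_quotient (hC : 4 ≤ minDist C) :
    3 * m ≤ 2 * finrank F (SymMat F m ⧸ C) := by
  have := minDist_le C
  have := QuadraticMap.three_mul_finrank_le (Q := veroneseMod C) (by simp; omega)
    (fun v hv => veroneseMod_ne_zero (by omega) hv)
    (fun v hv => by simpa using finrank_tangent_veroneseMod (by omega) hv)
    (fun v hv u hu => veroneseMod_not_mem_tangent hC hv hu)
  simpa using this

theorem coveringDensity_le_half (ht : (minDist C - 1) / 2 = 1)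
    (hk : m < finrank F (SymMat F m ⧸ C)) : coveringDensity C ≤ 1 / 2 := by
  have hq : (2 : ℝ) ≤ Nat.card F := by exact_mod_cast Finite.one_lt_card (α := F)
  obtain ⟨k, hk⟩ := Nat.exists_eq_add_of_lt hk
  have h := coveringDensity_mul_le ht
  have h0 := coveringDensity_nonneg C
  rw [hk, add_assoc, pow_add, mul_left_comm] at h
  have h1 := (mul_le_iff_le_one_right (by positivity)).1 h
  have h2 : (2 : ℝ) ≤ (Nat.card F : ℝ) ^ (k + 1) :=
    hq.trans (le_self_pow₀ (by linarith) (by omega))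
  nlinarith

theorem coveringDensity_le_rpow (hC : minDist C = 4) :
    coveringDensity C ≤ (Nat.card F : ℝ) ^ (-((m : ℝ) / 2)) := by
  have hq : (1 : ℝ) < Nat.card F := by exact_mod_cast Finite.one_lt_card (α := F)
  have h := coveringDensity_mul_le (C := C) (by omega)
  have hk : (3 : ℝ) * m ≤ 2 * finrank F (SymMat F m ⧸ C) := by
    exact_mod_cast three_mul_le_finrank_quotient hC.ge
  rw [← le_div_iff₀ (by positivity), ← Real.rpow_natCast, ← Real.rpow_natCast,
    ← Real.rpow_sub (by linarith)] at h
  exact h.trans (Real.rpow_le_rpow_of_exponent_le hq.le (by linarith))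

end SymRank

theorem mainTheorem5 {F : Type*} [Field F] [Finite F] (d : ℕ) (m : ℕ → ℕ)
    (C : ∀ i, SymRank.SymCode F (m i)) (hd : ∀ i, SymRank.minDist (C i) = d) :
    (d = 3 → {i : ℕ | Even (m i)}.Infinite → ¬ SymRank.QuasiPerfect C) ∧
    (d = 4 →
      (∀ i, SymRank.coveringDensity (C i) ≤ (Nat.card F : ℝ) ^ (-((m i : ℝ) / 2))) ∧
      (Tendsto m atTop atTop →
        Tendsto (fun i => SymRank.coveringDensity (C i)) atTop (𝓝 0)) ∧
      ¬ SymRank.QuasiPerfect C) := by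
  have hq : (1 : ℝ) < Nat.card F := by exact_mod_cast Finite.one_lt_card (α := F)
  refine ⟨?_, ?_⟩
  · rintro rfl hinf hC
    have h : ∃ᶠ i in atTop, SymRank.coveringDensity (C i) ≤ 1 / 2 :=
      (Nat.frequently_atTop_iff_infinite.2 hinf).mono fun i hi =>
        SymRank.coveringDensity_le_half (by rw [hd])
          (SymRank.lt_finrank_quotient_of_even (hd i).ge hi)
    have := le_of_tendsto_of_frequently hC h
    norm_num at this
  · rintro rfl
    have hle := fun i => SymRank.coveringDensity_le_rpow (hd i)
    refine ⟨hle, fun hm => ?_, fun hC => ?_⟩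
    · refine squeeze_zero (fun i => SymRank.coveringDensity_nonneg _) hle ?_
      refine (tendsto_rpow_atBot_of_base_gt_one _ hq).comp ?_
      exact tendsto_neg_atTop_atBot.comp
        ((tendsto_natCast_atTop_atTop.comp hm).atTop_div_const two_pos)
    -- Since `4 = minDist (C i) ≤ m i`, the bound `3m/2` strictly exceeds `m`, so the density stays
    -- below `1/2` even for bounded `m i`.
    · have := le_of_tendsto hC (Eventually.of_forall fun i =>
        SymRank.coveringDensity_le_half (C := C i) (by rw [hd]) (by
          have h1 := SymRank.three_mul_le_finrank_quotient (hd i).ge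
          have h2 := SymRank.minDist_le (C i)
          rw [hd] at h2
          omega))
      norm_num at this
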